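/- Let $K$ be a field of characteristic $0$ (for instance $K=\mathbb{C}$). For $\mu,s\in K$ define the Gaussian moments $m_i(\mu,s)\in K$ with mean $\mu$ and variance $s=\sigma^2$ by the identity of formal power series $$\sum_{i\ge 0}\frac{m_i(\mu,s)}{i!}\,t^i=\exp(\mu t)\cdot\exp\!\left(\tfrac12 s t^2\right).$$ For $d\ge 3$, let the Gaussian moment surface $\mathcal{G}_{1,d}\subset\mathbb{P}^d_K$ be the Zariski closure of the set of points $(m_0(\mu,s):m_1(\mu,s):\cdots:m_d(\mu,s))$ with $\mu,s\in K$, and let $I_d\subset K[m_0,\dots,m_d]$ be its homogeneous ideal, generated by all homogeneous polynomials that vanish on $\mathcal{G}_{1,d}$. Let $$H_d=\begin{pmatrix}0&m_0&2m_1&3m_2&\cdots&(d-1)m_{d-2}\\ m_0&m_1&m_2&m_3&\cdots&m_{d-1}\\ m_1&m_2&m_3&m_4&\cdots&m_d\end{pmatrix}.$$ Then $I_d$ is a homogeneous prime ideal, and it is minimally generated by the $3\times 3$-minors of $H_d$, which are $\binom d3$ distinct nonzero cubics: these minors generate $I_d$, no proper subset of them generates $I_d$, and no generating set of $I_d$ has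 fewer than $\binom d3$ elements. Moreover, the moments satisfy the recurrence encoded in $H_d$: $m_1=\mu m_0$ and $m_i=\mu\, m_{i-1}+(i-1)\,s\,m_{i-2}$ for $i\ge 2$. -/

import Mathlib

open scoped LinearAlgebra.Projectivization

attribute [local instance] MvPolynomial.gradedAlgebra

noncomputable section

namespace GaussianMoments

variable {K : Type*} [Field K]

/-- The moment generating function `exp(μ t) * exp(s t² / 2)` of the univariate Gaussian with
mean `μ` and variance `s`, as a formal power series in `t`. -/
def momentSeries [CharZero K] (μ s : K) : PowerSeries K :=
  (PowerSeries.exp K).subst (PowerSeries.C μ * PowerSeries.X : PowerSeries K) *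
    (PowerSeries.exp K).subst (PowerSeries.C (s / 2) * PowerSeries.X ^ 2 : PowerSeries K)

/-- The `i`-th moment `mᵢ`: the moment generating function is `∑ mᵢ tⁱ / i!`. -/
def moment [CharZero K] (μ s : K) (i : ℕ) : K :=
  (i.factorial : K) * PowerSeries.coeff i (momentSeries μ s)

theorem constantCoeff_exp_subst [CharZero K] (a : PowerSeries K)
    (ha : PowerSeries.constantCoeff a = 0) :
    PowerSeries.constantCoeff ((PowerSeries.exp K).subst a) = 1 := by
  have hs : PowerSeries.HasSubst a := PowerSeries.HasSubst.of_constantCoeff_zero' ha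
  have h0 : PowerSeries.constantCoeff ((PowerSeries.exp K - 1).subst a) = 0 :=
    PowerSeries.constantCoeff_subst_eq_zero ha _ (by simp)
  have h1 : (PowerSeries.exp K).subst a = (PowerSeries.exp K - 1).subst a + 1 := by
    rw [← PowerSeries.coe_substAlgHom hs]
    simp
  rw [h1, map_add, h0]
  simp

theorem moment_zero [CharZero K] (μ s : K) : moment μ s 0 = 1 := by
  simp only [moment, momentSeries, PowerSeries.coeff_zero_eq_constantCoeff_apply, map_mul]
  rw [constantCoeff_exp_subst _ (by simp), constantCoeff_exp_subst _ (by simp)]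
  simp

/-- The vector `(m₀, m₁, …, m_d)` of moments of order at most `d`. -/
def momentVector [CharZero K] (d : ℕ) (μ s : K) : Fin (d + 1) → K := fun i => moment μ s i

theorem momentVector_ne_zero [CharZero K] (d : ℕ) (μ s : K) : momentVector d μ s ≠ 0 := by
  intro h
  have h0 := congrFun h 0
  simp [momentVector, moment_zero] at h0

/-- The point `(m₀ : m₁ : ⋯ : m_d)` of `ℙ^d`. -/
def momentPoint [CharZero K] (d : ℕ) (μ s : K) : ℙ K (Fin (d + 1) → K) :=
  Projectivization.mk K (momentVector d μ s) (momentVector_ne_zero d μ s)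

/-- The homogeneous polynomials that vanish on a subset `Z` of projective space. (For a homogeneous
polynomial, vanishing at a point does not depend on the representative.) -/
def homogeneousVanishing {n : ℕ} (Z : Set (ℙ K (Fin n → K))) : Set (MvPolynomial (Fin n) K) :=
  {f | (∃ k, f.IsHomogeneous k) ∧ ∀ p ∈ Z, MvPolynomial.eval p.rep f = 0}

/-- The Zariski closure of a subset of projective space. -/
def zariskiClosure {n : ℕ} (Z : Set (ℙ K (Fin n → K))) : Set (ℙ K (Fin n → K)) :=
  {p | ∀ f ∈ homogeneousVanishing Z, MvPolynomial.eval p.rep f = 0}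

/-- The homogeneous ideal of a subset of projective space. -/
def projectiveIdeal {n : ℕ} (Z : Set (ℙ K (Fin n → K))) : Ideal (MvPolynomial (Fin n) K) :=
  Ideal.span (homogeneousVanishing Z)

/-- The Gaussian moment surface `𝒢_{1,d}` in `ℙ^d`: the Zariski closure of the set of moment
points over all values of the mean and the variance in `K`. -/
def momentSurface (K : Type*) [Field K] [CharZero K] (d : ℕ) : Set (ℙ K (Fin (d + 1) → K)) :=
  zariskiClosure {p | ∃ μ s : K, p = momentPoint d μ s}

/-- The `3 × d` matrix `H_d`, with column `j = 0, …, d - 1` equal to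
`(j * m_{j-1}, m_j, m_{j+1})`; the top entry of column `0` is `0`. -/
def hMatrix (K : Type*) [Field K] (d : ℕ) :
    Matrix (Fin 3) (Fin d) (MvPolynomial (Fin (d + 1)) K) :=
  Matrix.of ![
    fun j => MvPolynomial.C ((j : ℕ) : K) * MvPolynomial.X ⟨(j : ℕ) - 1, by omega⟩,
    fun j => MvPolynomial.X j.castSucc,
    fun j => MvPolynomial.X j.succ]

/-- The `3 × 3` minor of `H_d` on the columns `c 0 < c 1 < c 2`. -/
def hMinor (K : Type*) [Field K] (d : ℕ) (c : Fin 3 ↪o Fin d) : MvPolynomial (Fin (d + 1)) K :=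
  ((hMatrix K d).submatrix id c).det

end GaussianMoments

end

noncomputable section

namespace GaussianMoments

open MvPolynomial

variable {K : Type*} [Field K]

/-! The generating function satisfies M' = (μ + s t) M. This is the recurrence, and on moments it
makes the third row of `hMatrix` equal to μ times the second plus s times the first, so the minors
vanish. As `K` is infinite, the forms in the ideal are exactly those killed by `momentHom`, whose
target K[μ, s] is a domain; primality follows.

Generation is a Gröbner-type count. In the minor on columns a < b < c, the monomial with least sum
of squared indices is m_{a+1} m_b m_{c-1}, and these run through all cubic monomials in the inner
variables m_1, …, m_{d-2}. So modulo the minors only standard monomials, of inner degree at most 2,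
are needed (`monomial_mem_span_hMinor_sup`). Give μ, s, m_i the weights 1, 2, i. At most ⌊w/2⌋ + 1
standard monomials without m_0 have weight w (`exists_finset_standard`), which is the dimension of
the weight-w part of K[μ, s]. Their images span that part, hence are independent, so a form in the
kernel reduces to 0 modulo the minors.

Distinct lead monomials make the minors linearly independent, and independent forms of one degree
generate their ideal minimally (`card_le_card_of_span_eq`). -/

/-! ### The recurrence for the moments -/

theorem derivative_momentSeries [CharZero K] (μ s : K) :
    PowerSeries.derivative K (momentSeries μ s) =
      (PowerSeries.C μ + PowerSeries.C s * PowerSeries.X) * momentSeries μ s := by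
  have h₁ : PowerSeries.HasSubst (PowerSeries.C μ * PowerSeries.X : PowerSeries K) :=
    PowerSeries.HasSubst.of_constantCoeff_zero' (by simp)
  have h₂ : PowerSeries.HasSubst (PowerSeries.C (s / 2) * PowerSeries.X ^ 2 : PowerSeries K) :=
    PowerSeries.HasSubst.of_constantCoeff_zero' (by simp)
  have e₁ : PowerSeries.derivative K (PowerSeries.C μ * PowerSeries.X : PowerSeries K) =
      PowerSeries.C μ := by
    rw [← PowerSeries.smul_eq_C_mul, Derivation.map_smul, PowerSeries.derivative_X,
      PowerSeries.smul_eq_C_mul, mul_one]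
  have e₂ : PowerSeries.derivative K (PowerSeries.C (s / 2) * PowerSeries.X ^ 2 : PowerSeries K) =
      PowerSeries.C s * PowerSeries.X := by
    rw [← PowerSeries.smul_eq_C_mul, Derivation.map_smul, Derivation.leibniz_pow,
      PowerSeries.derivative_X, ← PowerSeries.smul_eq_C_mul, ← Nat.cast_smul_eq_nsmul K, smul_smul]
    simp
  simp only [momentSeries, Derivation.leibniz, PowerSeries.derivative_subst h₁,
    PowerSeries.derivative_subst h₂, PowerSeries.derivative_exp, e₁, e₂, smul_eq_mul]
  ring

theorem moment_succ_succ [CharZero K] (μ s : K) (i : ℕ) :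
    moment μ s (i + 2) = μ * moment μ s (i + 1) + (i + 1) * s * moment μ s i := by
  have h := congrArg (PowerSeries.coeff (i + 1)) (derivative_momentSeries μ s)
  rw [PowerSeries.coeff_derivative, add_mul, map_add, PowerSeries.coeff_C_mul, mul_assoc,
    PowerSeries.coeff_C_mul, PowerSeries.coeff_succ_X_mul] at h
  simp only [moment, Nat.factorial_succ]
  push_cast at h ⊢
  linear_combination (((i : K) + 1) * (i.factorial : K)) * h

theorem moment_one [CharZero K] (μ s : K) : moment μ s 1 = μ := by
  have h := congrArg (PowerSeries.coeff 0) (derivative_momentSeries μ s)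
  rw [PowerSeries.coeff_derivative, add_mul, map_add, PowerSeries.coeff_C_mul, mul_assoc,
    PowerSeries.coeff_C_mul, PowerSeries.coeff_zero_X_mul] at h
  have h0 := moment_zero μ s
  simp only [moment, Nat.factorial] at h0 ⊢
  push_cast at h h0 ⊢
  linear_combination h + μ * h0

/-! ### The parametrization and the homogeneous ideal -/

/-- The moments as polynomials in the mean `X 0` and the variance `X 1`. -/
def momentPoly (K : Type*) [Field K] : ℕ → MvPolynomial (Fin 2) K
  | 0 => 1
  | 1 => X 0
  | i + 2 => X 0 * momentPoly K (i + 1) + C ((i : K) + 1) * X 1 * momentPoly K i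

theorem eval_momentPoly [CharZero K] (x : Fin 2 → K) (i : ℕ) :
    eval x (momentPoly K i) = moment (x 0) (x 1) i := by
  induction i using Nat.twoStepInduction with
  | zero => simp [momentPoly, moment_zero]
  | one => simp [momentPoly, moment_one]
  | more i h₀ h₁ => simp [momentPoly, moment_succ_succ, h₀, h₁]

/-- The truncated index at `i = 0` carries the coefficient 0, just as in column 0 of `hMatrix`. -/
theorem momentPoly_succ (i : ℕ) :
    momentPoly K (i + 1) =
      X 0 * momentPoly K i + X 1 * (C (i : K) * momentPoly K (i - 1)) := by
  cases i with
  | zero => simp [momentPoly]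
  | succ i => simp [momentPoly]; ring

/-- The parametrization of the affine chart `m₀ = 1` of the moment surface. -/
def momentHom (K : Type*) [Field K] (d : ℕ) :
    MvPolynomial (Fin (d + 1)) K →ₐ[K] MvPolynomial (Fin 2) K :=
  aeval fun i => momentPoly K i

theorem eval_momentHom [CharZero K] {d : ℕ} (x : Fin 2 → K) (f : MvPolynomial (Fin (d + 1)) K) :
    eval x (momentHom K d f) = eval (momentVector d (x 0) (x 1)) f := by
  have : (aeval x).comp (momentHom K d) =
      (aeval (momentVector d (x 0) (x 1)) : MvPolynomial (Fin (d + 1)) K →ₐ[K] K) := by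
    ext i
    simp [momentHom, momentVector, aeval_eq_eval, eval_momentPoly]
  simpa [aeval_eq_eval] using DFunLike.congr_fun this f

theorem eval_smul_of_isHomogeneous {σ : Type*} [Fintype σ] {f : MvPolynomial σ K} {k : ℕ}
    (hf : f.IsHomogeneous k) (a : K) (v : σ → K) : eval (a • v) f = a ^ k * eval v f := by
  rw [eval_eq', eval_eq', Finset.mul_sum]
  refine Finset.sum_congr rfl fun e he => ?_
  have hk : ∑ i, e i = k := by
    rw [← Finsupp.degree_eq_sum, Finsupp.degree_apply, ← hf.degree_eq_sum_deg_support he]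
  simp only [Pi.smul_apply, smul_eq_mul, mul_pow, Finset.prod_mul_distrib,
    Finset.prod_pow_eq_pow_sum,
    hk]
  ring

theorem homogeneousVanishing_zariskiClosure {n : ℕ} (Z : Set (ℙ K (Fin n → K))) :
    homogeneousVanishing (zariskiClosure Z) = homogeneousVanishing Z := by
  ext f
  refine ⟨fun h => ⟨h.1, fun p hp => h.2 p fun g hg => hg.2 p hp⟩,
    fun h => ⟨h.1, fun p hp => hp f h⟩⟩

theorem mem_homogeneousVanishing_momentSurface [CharZero K] {d : ℕ}
    {f : MvPolynomial (Fin (d + 1)) K} :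
    f ∈ homogeneousVanishing (momentSurface K d) ↔
      (∃ k, f.IsHomogeneous k) ∧ momentHom K d f = 0 := by
  rw [momentSurface, homogeneousVanishing_zariskiClosure]
  refine and_congr_right fun ⟨k, hk⟩ => ?_
  have key (μ s : K) : eval (momentPoint d μ s).rep f = 0 ↔ eval (momentVector d μ s) f = 0 := by
    obtain ⟨a, ha⟩ := Projectivization.exists_smul_eq_mk_rep K (momentVector d μ s)
      (momentVector_ne_zero d μ s)
    rw [momentPoint, ← ha, Units.smul_def, eval_smul_of_isHomogeneous hk]
    simp
  constructor
  · intro h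
    -- A polynomial vanishing at all points is zero because `K` is infinite.
    refine MvPolynomial.funext fun x => ?_
    rw [eval_momentHom, map_zero]
    exact (key _ _).1 (h _ ⟨_, _, rfl⟩)
  · rintro h _ ⟨μ, s, rfl⟩
    rw [key]
    have := eval_momentHom (d := d) ![μ, s] f
    simpa [h] using this.symm

theorem momentHom_eq_zero_of_mem [CharZero K] {d : ℕ} {f : MvPolynomial (Fin (d + 1)) K}
    (hf : f ∈ projectiveIdeal (momentSurface K d)) : momentHom K d f = 0 := by
  have : projectiveIdeal (momentSurface K d) ≤ RingHom.ker (momentHom K d) :=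
    Ideal.span_le.2 fun g hg => (mem_homogeneousVanishing_momentSurface.1 hg).2
  exact this hf

theorem mem_projectiveIdeal_momentSurface [CharZero K] {d k : ℕ}
    {f : MvPolynomial (Fin (d + 1)) K} (hf : f.IsHomogeneous k) (h : momentHom K d f = 0) :
    f ∈ projectiveIdeal (momentSurface K d) :=
  Ideal.subset_span (mem_homogeneousVanishing_momentSurface.2 ⟨⟨k, hf⟩, h⟩)

theorem isHomogeneous_projectiveIdeal {n : ℕ} (Z : Set (ℙ K (Fin n → K))) :
    (projectiveIdeal Z).IsHomogeneous (homogeneousSubmodule (Fin n) K) :=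
  Ideal.homogeneous_span _ _ fun _ hf => hf.1

/-- Primality of a homogeneous ideal may be tested on forms, where membership means lying in the
kernel of a map to a domain. -/
theorem isPrime_projectiveIdeal_momentSurface [CharZero K] (d : ℕ) :
    (projectiveIdeal (momentSurface K d)).IsPrime := by
  refine (isHomogeneous_projectiveIdeal _).isPrime_of_homogeneous_mem_or_mem ?_ ?_
  · intro h
    have := momentHom_eq_zero_of_mem ((Ideal.eq_top_iff_one _).1 h)
    simp at this
  · rintro f g ⟨k, hf⟩ ⟨l, hg⟩ hfg
    have := momentHom_eq_zero_of_mem hfg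
    rw [map_mul, mul_eq_zero] at this
    exact this.imp (mem_projectiveIdeal_momentSurface hf) (mem_projectiveIdeal_momentSurface hg)

/-! ### The minors and their lead monomials -/

theorem hMinor_eq (d : ℕ) (c : Fin 3 ↪o Fin d) :
    hMinor K d c =
      C ((c 0 : ℕ) : K) * X ⟨(c 0 : ℕ) - 1, by omega⟩ * X (c 1).castSucc * X (c 2).succ
      - C ((c 0 : ℕ) : K) * X ⟨(c 0 : ℕ) - 1, by omega⟩ * X (c 2).castSucc * X (c 1).succ
      - C ((c 1 : ℕ) : K) * X ⟨(c 1 : ℕ) - 1, by omega⟩ * X (c 0).castSucc * X (c 2).succ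
      + C ((c 1 : ℕ) : K) * X ⟨(c 1 : ℕ) - 1, by omega⟩ * X (c 2).castSucc * X (c 0).succ
      + C ((c 2 : ℕ) : K) * X ⟨(c 2 : ℕ) - 1, by omega⟩ * X (c 0).castSucc * X (c 1).succ
      - C ((c 2 : ℕ) : K) * X ⟨(c 2 : ℕ) - 1, by omega⟩ * X (c 1).castSucc * X (c 0).succ := by
  rw [hMinor, Matrix.det_fin_three]
  simp only [hMatrix, Matrix.submatrix_apply, Matrix.of_apply, id, Matrix.cons_val_zero,
    Matrix.cons_val_one, Matrix.cons_val]

theorem isHomogeneous_hMinor (d : ℕ) (c : Fin 3 ↪o Fin d) : (hMinor K d c).IsHomogeneous 3 := by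
  rw [hMinor_eq]
  have h (r : K) (i j k : Fin (d + 1)) : (C r * X i * X j * X k).IsHomogeneous 3 :=
    (((isHomogeneous_C_mul_X r i).mul (isHomogeneous_X K j)).mul (isHomogeneous_X K k))
  exact (((((h _ _ _ _).sub (h _ _ _ _)).sub (h _ _ _ _)).add (h _ _ _ _)).add (h _ _ _ _)).sub
    (h _ _ _ _)

theorem momentHom_hMinor (d : ℕ) (c : Fin 3 ↪o Fin d) : momentHom K d (hMinor K d c) = 0 := by
  rw [hMinor_eq]
  simp only [momentHom, map_sub, map_add, map_mul, aeval_X, Fin.val_succ, Fin.val_castSucc,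
    momentPoly_succ, algHom_C, algebraMap_eq]
  ring

/-- The sum of the squares of the indices of the variables of a monomial, with multiplicity. -/
def spread {n : ℕ} : (Fin n →₀ ℕ) →+ ℕ := Finsupp.weight fun i : Fin n => (i : ℕ) ^ 2

/-- The degree of a monomial in the inner variables `m₁, …, m_{d-2}`. -/
def innerDegree (d : ℕ) : (Fin (d + 1) →₀ ℕ) →+ ℕ :=
  Finsupp.weight fun i : Fin (d + 1) => if 1 ≤ (i : ℕ) ∧ (i : ℕ) + 2 ≤ d then 1 else 0

@[simp]
theorem spread_single {n : ℕ} (i : Fin n) (r : ℕ) :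
    spread (Finsupp.single i r) = r * (i : ℕ) ^ 2 := by
  simp [spread, Finsupp.weight_single]

theorem spread_le {d : ℕ} (e : Fin (d + 1) →₀ ℕ) : spread e ≤ e.degree * d ^ 2 := by
  rw [spread, Finsupp.weight_eq_sum, Finsupp.degree_eq_sum, Finset.sum_mul]
  refine Finset.sum_le_sum fun i _ => ?_
  rw [smul_eq_mul]
  gcongr
  omega

/-- The exponent of the antidiagonal term `m_{a+1} m_b m_{c-1}` of the minor on the columns
`a < b < c`. -/
def leadExponent {d : ℕ} (c : Fin 3 ↪o Fin d) : Fin (d + 1) →₀ ℕ :=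
  Finsupp.single (c 0).succ 1 + Finsupp.single (c 1).castSucc 1 +
    Finsupp.single ⟨(c 2 : ℕ) - 1, by omega⟩ 1

theorem cols_lt {d : ℕ} (c : Fin 3 ↪o Fin d) :
    (c 0 : ℕ) < (c 1 : ℕ) ∧ (c 1 : ℕ) < (c 2 : ℕ) :=
  ⟨c.strictMono (by decide), c.strictMono (by decide)⟩

/-- Since a + 1 ≤ b ≤ c - 1, the three indices are already sorted, so their multiset determines the
columns. -/
theorem leadExponent_injective {d : ℕ} :
    Function.Injective (leadExponent : (Fin 3 ↪o Fin d) → _) := by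
  intro c c' h
  have h₁ := cols_lt c
  have h₂ := cols_lt c'
  have hm := congrArg (fun e => (Finsupp.toMultiset e).map Fin.val) h
  simp only [leadExponent, map_add, Finsupp.toMultiset_single, one_smul, Multiset.map_add,
    Multiset.map_singleton, Fin.val_succ, Fin.val_castSucc] at hm
  change ((↑[(c 0 : ℕ) + 1, (c 1 : ℕ), (c 2 : ℕ) - 1] : Multiset ℕ)) =
    ↑[(c' 0 : ℕ) + 1, (c' 1 : ℕ), (c' 2 : ℕ) - 1] at hm
  have hl := (Multiset.coe_eq_coe.1 hm).eq_of_pairwise' (r := (· ≤ ·))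
    (by simp; omega) (by simp; omega)
  simp only [List.cons.injEq, and_true] at hl
  ext i
  fin_cases i
  · exact Nat.succ_injective hl.1
  · exact hl.2.1
  · change (c 2 : ℕ) = c' 2
    omega

theorem C_mul_X_mul_X_mul_X {n : ℕ} (r : K) (i j k : Fin n) :
    C r * X i * X j * X k =
      monomial (Finsupp.single i 1 + Finsupp.single j 1 + Finsupp.single k 1) r := by
  rw [C_mul_X_eq_monomial, X, X, monomial_mul, monomial_mul, mul_one, mul_one]

/-- A term takes index j + ε_j from each column j, with the ε_j a permutation of -1, 0, 1. Its sum
of squares is a constant plus 2 ∑ ε_j j, strictly least when ε decreases (rearrangement). -/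
theorem hMinor_tail_mem (d : ℕ) (c : Fin 3 ↪o Fin d) :
    hMinor K d c + monomial (leadExponent c) ((c 2 : ℕ) : K) ∈
      restrictSupport K {e | e.degree = 3 ∧ spread (leadExponent c) < spread e} := by
  obtain ⟨h₁, h₂⟩ := cols_lt c
  have hlead : leadExponent c = Finsupp.single ⟨(c 2 : ℕ) - 1, by omega⟩ 1 +
      Finsupp.single (c 1).castSucc 1 + Finsupp.single (c 0).succ 1 := by
    rw [leadExponent]; abel
  have key (r : ℕ) (i j k : Fin (d + 1)) (h : r = 0 ∨ ((c 0 : ℕ) + 1) ^ 2 + (c 1 : ℕ) ^ 2 +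
      ((c 2 : ℕ) - 1) ^ 2 < (i : ℕ) ^ 2 + (j : ℕ) ^ 2 + (k : ℕ) ^ 2) :
      C (r : K) * X i * X j * X k ∈
        restrictSupport K {e | e.degree = 3 ∧ spread (leadExponent c) < spread e} := by
    rw [C_mul_X_mul_X_mul_X, monomial_mem_restrictSupport]
    rcases h with rfl | h
    · exact Or.inr Nat.cast_zero
    · exact Or.inl ⟨by simp, by simpa [leadExponent] using h⟩
  rw [hMinor_eq, C_mul_X_mul_X_mul_X _ ⟨(c 2 : ℕ) - 1, _⟩ (c 1).castSucc (c 0).succ, ← hlead,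
    sub_add_cancel]
  refine add_mem (add_mem (sub_mem (sub_mem (key _ _ _ _ ?_) (key _ _ _ _ ?_)) (key _ _ _ _ ?_))
    (key _ _ _ _ ?_)) (key _ _ _ _ ?_)
  all_goals
    simp only [Fin.val_succ, Fin.val_castSucc]
    generalize (c 0 : ℕ) = i at *
    obtain ⟨j, hj⟩ : ∃ j, (c 1 : ℕ) = j + 1 := ⟨_, (Nat.sub_add_cancel (by omega)).symm⟩
    obtain ⟨k, hk⟩ : ∃ k, (c 2 : ℕ) = k + 1 := ⟨_, (Nat.sub_add_cancel (by omega)).symm⟩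
    rw [hj] at h₁ h₂ ⊢
    rw [hk] at h₂ ⊢
    simp only [Nat.add_sub_cancel]
  -- For column 0 the truncated index `0 - 1` comes with coefficient 0, so there is nothing to
  -- compare.
  on_goal 1 => rcases i with _ | i
  on_goal 3 => rcases i with _ | i
  · exact Or.inl rfl
  · right; simp only [Nat.add_sub_cancel]; nlinarith
  · exact Or.inl rfl
  · right; simp only [Nat.add_sub_cancel]; nlinarith
  all_goals right; nlinarith

theorem coeff_leadExponent_hMinor (d : ℕ) (c : Fin 3 ↪o Fin d) :
    coeff (leadExponent c) (hMinor K d c) = -((c 2 : ℕ) : K) := by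
  have h : leadExponent c ∉ (hMinor K d c + monomial (leadExponent c) ((c 2 : ℕ) : K)).support :=
    fun h => lt_irrefl _ (hMinor_tail_mem d c h).2
  rw [notMem_support_iff, coeff_add, coeff_monomial, if_pos rfl] at h
  exact eq_neg_of_add_eq_zero_left h

theorem coeff_leadExponent_hMinor_of_ne {d : ℕ} {c c' : Fin 3 ↪o Fin d} (hne : c' ≠ c)
    (hle : spread (leadExponent c) ≤ spread (leadExponent c')) :
    coeff (leadExponent c) (hMinor K d c') = 0 := by
  have h : leadExponent c ∉
      (hMinor K d c' + monomial (leadExponent c') ((c' 2 : ℕ) : K)).support :=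
    fun h => (hMinor_tail_mem d c' h).2.not_ge hle
  rwa [notMem_support_iff, coeff_add, coeff_monomial,
    if_neg fun h => hne (leadExponent_injective h), add_zero] at h

/-- Ordered by `spread`, the coefficients at the lead monomials form a triangular matrix, with
diagonal entries `-(c 2)` that are nonzero in characteristic 0. -/
theorem linearIndependent_hMinor [CharZero K] (d : ℕ) : LinearIndependent K (hMinor K d) := by
  rw [linearIndependent_iff']
  intro s g hg c hc
  induction hn : spread (leadExponent c) using Nat.strong_induction_on generalizing c with
  | _ n ih =>
    subst hn
    have h := congrArg (coeff (leadExponent c)) hg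
    rw [coeff_sum, coeff_zero, Finset.sum_eq_single_of_mem c hc, coeff_smul,
      coeff_leadExponent_hMinor, smul_eq_mul, mul_neg, neg_eq_zero, mul_eq_zero] at h
    · refine h.resolve_right (Nat.cast_ne_zero.2 ?_)
      have := cols_lt c
      omega
    · intro c' hc' hne
      rcases lt_or_ge (spread (leadExponent c')) (spread (leadExponent c)) with hlt | hle
      · rw [ih _ hlt c' hc' rfl, zero_smul, coeff_zero]
      · rw [coeff_smul, coeff_leadExponent_hMinor_of_ne hne hle, smul_zero]

theorem ncard_range_hMinor [CharZero K] (d : ℕ) : (Set.range (hMinor K d)).ncard = d.choose 3 := by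
  rw [Set.ncard_range_of_injective (linearIndependent_hMinor d).injective,
    Nat.card_congr Set.powersetCard.ofFinEmbEquiv, Set.powersetCard.card, Nat.card_fin]

theorem exists_inner_add {d : ℕ} {e : Fin (d + 1) →₀ ℕ} (he : 0 < innerDegree d e) :
    ∃ (i : Fin (d + 1)) (e' : Fin (d + 1) →₀ ℕ), 1 ≤ (i : ℕ) ∧ (i : ℕ) + 2 ≤ d ∧
      e = e' + Finsupp.single i 1 ∧ innerDegree d e = innerDegree d e' + 1 := by
  rw [innerDegree, Finsupp.weight_eq_sum, Finset.sum_pos_iff] at he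
  obtain ⟨i, -, hi⟩ := he
  split_ifs at hi with hmid
  · have hle : Finsupp.single i 1 ≤ e :=
      Finsupp.single_le_iff.2 (Nat.succ_le_of_lt (by simpa using hi))
    refine ⟨i, e - Finsupp.single i 1, hmid.1, hmid.2, (tsub_add_cancel_of_le hle).symm, ?_⟩
    conv_lhs => rw [← tsub_add_cancel_of_le hle, map_add]
    congr 1
    simp [innerDegree, Finsupp.weight_single, hmid]
  · simp at hi

/-- Inner indices i ≤ j ≤ k are the lead indices of the columns i - 1 < j < k + 1, which exist
because 1 ≤ i and k + 2 ≤ d. -/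
theorem exists_leadExponent_add {d : ℕ} {e : Fin (d + 1) →₀ ℕ} (he : 2 < innerDegree d e) :
    ∃ (c : Fin 3 ↪o Fin d) (e' : Fin (d + 1) →₀ ℕ), e = e' + leadExponent c := by
  have sorted (i j k : Fin (d + 1)) (hi : 1 ≤ (i : ℕ)) (hk : (k : ℕ) + 2 ≤ d) (hij : i ≤ j)
      (hjk : j ≤ k) : ∃ c : Fin 3 ↪o Fin d,
        leadExponent c = Finsupp.single i 1 + Finsupp.single j 1 + Finsupp.single k 1 := by
    rw [Fin.le_def] at hij hjk
    let v : Fin 3 → Fin d := ![⟨(i : ℕ) - 1, by omega⟩, ⟨j, by omega⟩, ⟨(k : ℕ) + 1, by omega⟩]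
    have hv : StrictMono v := by
      rw [Fin.strictMono_iff_lt_succ]
      intro t
      fin_cases t
      · change (i : ℕ) - 1 < j
        omega
      · change (j : ℕ) < k + 1
        omega
    refine ⟨OrderEmbedding.ofStrictMono v hv, ?_⟩
    rw [leadExponent]
    congr 3
    ext
    change (i : ℕ) - 1 + 1 = i
    omega
  obtain ⟨i, e₁, hi, hi', rfl, h₁⟩ := exists_inner_add (by omega : 0 < innerDegree d e)
  obtain ⟨j, e₂, hj, hj', rfl, h₂⟩ := exists_inner_add (by omega : 0 < innerDegree d e₁)
  obtain ⟨k, e', hk, hk', rfl, h₃⟩ := exists_inner_add (by omega : 0 < innerDegree d e₂)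
  suffices h : ∃ c : Fin 3 ↪o Fin d,
      leadExponent c = Finsupp.single i 1 + Finsupp.single j 1 + Finsupp.single k 1 by
    obtain ⟨c, hc⟩ := h
    exact ⟨c, e', by rw [hc]; abel⟩
  rcases le_total i j with hij | hij <;> rcases le_total j k with hjk | hjk <;>
    rcases le_total i k with hik | hik
  · exact sorted i j k hi hk' hij hjk
  · exact sorted i j k hi hk' hij hjk
  · obtain ⟨c, hc⟩ := sorted i k j hi hj' hik hjk
    exact ⟨c, by rw [hc]; abel⟩
  · obtain ⟨c, hc⟩ := sorted k i j hk hj' hik hij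
    exact ⟨c, by rw [hc]; abel⟩
  · obtain ⟨c, hc⟩ := sorted j i k hj hk' hij hik
    exact ⟨c, by rw [hc]; abel⟩
  · obtain ⟨c, hc⟩ := sorted j k i hj hi' hjk hik
    exact ⟨c, by rw [hc]; abel⟩
  · obtain ⟨c, hc⟩ := sorted k j i hk hi' hjk hij
    exact ⟨c, by rw [hc]; abel⟩
  · obtain ⟨c, hc⟩ := sorted k j i hk hi' hjk hij
    exact ⟨c, by rw [hc]; abel⟩

/-! ### Reduction to standard monomials -/

/-- Modulo the minors, a monomial is a combination of monomials of the same degree that have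
degree at most two in the inner variables. -/
theorem monomial_mem_span_hMinor_sup [CharZero K] {d : ℕ} (e : Fin (d + 1) →₀ ℕ) :
    monomial e (1 : K) ∈ (Ideal.span (Set.range (hMinor K d))).restrictScalars K ⊔
      restrictSupport K {f | innerDegree d f ≤ 2 ∧ f.degree = e.degree} := by
  -- Rewriting by a minor keeps the degree and raises `spread`, which `spread_le` bounds.
  induction hn : e.degree * d ^ 2 - spread e using Nat.strong_induction_on generalizing e with
  | _ n ih =>
    subst hn
    rcases le_or_gt (innerDegree d e) 2 with hle | hgt
    · exact Submodule.mem_sup_right ((monomial_mem_restrictSupport K).2 (Or.inl ⟨hle, rfl⟩))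
    obtain ⟨c, e', rfl⟩ := exists_leadExponent_add hgt
    set N := (Ideal.span (Set.range (hMinor K d))).restrictScalars K ⊔
      restrictSupport K {f | innerDegree d f ≤ 2 ∧ f.degree = (e' + leadExponent c).degree}
      with hN
    have hc : ((c 2 : ℕ) : K) ≠ 0 := Nat.cast_ne_zero.2 (by have := cols_lt c; omega)
    set g := hMinor K d c + monomial (leadExponent c) ((c 2 : ℕ) : K) with hg
    have heq : monomial (e' + leadExponent c) (1 : K) =
        ((c 2 : ℕ) : K)⁻¹ • (monomial e' (1 : K) * g - monomial e' (1 : K) * hMinor K d c) := by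
      rw [hg, mul_add, add_sub_cancel_left, monomial_mul, smul_monomial, one_mul, smul_eq_mul,
        inv_mul_cancel₀ hc]
    rw [heq]
    refine N.smul_mem _ (N.sub_mem ?_ ?_)
    · rw [g.as_sum, Finset.mul_sum]
      refine N.sum_mem fun f hf => ?_
      obtain ⟨hdeg, hlt⟩ := hMinor_tail_mem d c hf
      have hdeg' : (e' + f).degree = (e' + leadExponent c).degree := by
        rw [map_add, map_add, hdeg]
        simp [leadExponent]
      have := ih _ ?_ (e' + f) rfl
      · rw [hdeg', ← hN] at this
        rw [monomial_mul, one_mul, ← mul_one (coeff f g), ← smul_eq_mul, ← smul_monomial]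
        exact N.smul_mem _ this
      · have h₁ := spread_le (e' + f)
        rw [hdeg'] at h₁ ⊢
        rw [map_add spread] at h₁ ⊢
        rw [map_add spread e' (leadExponent c)]
        omega
    · exact Submodule.mem_sup_left (Ideal.mul_mem_left _ _ (Ideal.subset_span ⟨c, rfl⟩))

/-! ### Counting standard monomials by weight -/

/-- The sum of the indices of the variables of a monomial, with multiplicity. -/
def indexWeight {n : ℕ} : (Fin n →₀ ℕ) →+ ℕ := Finsupp.weight fun i : Fin n => (i : ℕ)

@[simp]
theorem indexWeight_single {n : ℕ} (i : Fin n) (r : ℕ) :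
    indexWeight (Finsupp.single i r) = r * (i : ℕ) := by
  simp [indexWeight, Finsupp.weight_single]

theorem innerDegree_single_of_not {d : ℕ} {i : Fin (d + 1)}
    (hi : ¬(1 ≤ (i : ℕ) ∧ (i : ℕ) + 2 ≤ d)) (r : ℕ) :
    innerDegree d (Finsupp.single i r) = 0 := by
  simp [innerDegree, Finsupp.weight_single, hi]

theorem eq_zero_of_innerDegree_eq_zero {d : ℕ} {e : Fin (d + 1) →₀ ℕ}
    (h : ∀ i : Fin (d + 1), ¬(1 ≤ (i : ℕ) ∧ (i : ℕ) + 2 ≤ d) → e i = 0)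
    (he : innerDegree d e = 0) : e = 0 := by
  ext i
  by_cases hi : 1 ≤ (i : ℕ) ∧ (i : ℕ) + 2 ≤ d
  · rw [innerDegree, Finsupp.weight_eq_sum, Finset.sum_eq_zero_iff] at he
    simpa [hi] using he i (Finset.mem_univ i)
  · exact h i hi

/-- The number of standard monomials of weight `w` in the inner variables only. -/
theorem exists_finset_inner {d : ℕ} (hd : 3 ≤ d) (w : ℕ) :
    ∃ F : Finset (Fin (d + 1) →₀ ℕ), F.card ≤ w / 2 + 1 - (w + 2 - d) ∧
      ∀ e : Fin (d + 1) →₀ ℕ, (∀ i : Fin (d + 1), ¬(1 ≤ (i : ℕ) ∧ (i : ℕ) + 2 ≤ d) → e i = 0) →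
        innerDegree d e ≤ 2 → indexWeight e = w → e ∈ F := by
  classical
  -- Index 0 stands for an absent factor, so pairs `i`, `w - i` cover inner degrees 0, 1 and 2. The
  -- range of `i` below expresses w - i ≤ d - 2 and i ≤ w - i.
  let u : ℕ → (Fin (d + 1) →₀ ℕ) := fun i =>
    if h : 1 ≤ i ∧ i + 2 ≤ d then Finsupp.single ⟨i, by omega⟩ 1 else 0
  have u_zero : u 0 = 0 := by simp [u]
  have u_coe (i : Fin (d + 1)) (h : 1 ≤ (i : ℕ)) (h' : (i : ℕ) + 2 ≤ d) :
      u i = Finsupp.single i 1 := by simp [u, h, h']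
  refine ⟨(Finset.Icc (w + 2 - d) (w / 2)).image fun i => u i + u (w - i),
    Finset.card_image_le.trans (Nat.card_Icc _ _).le, fun e h0 hdeg hw => ?_⟩
  subst hw
  simp only [Finset.mem_image, Finset.mem_Icc]
  have sub {e e' : Fin (d + 1) →₀ ℕ} {i : Fin (d + 1)} (he : e = e' + Finsupp.single i 1)
      (h : ∀ i : Fin (d + 1), ¬(1 ≤ (i : ℕ) ∧ (i : ℕ) + 2 ≤ d) → e i = 0) :
      ∀ i : Fin (d + 1), ¬(1 ≤ (i : ℕ) ∧ (i : ℕ) + 2 ≤ d) → e' i = 0 := by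
    intro j hj
    have := h j hj
    rw [he, Finsupp.add_apply] at this
    omega
  rcases Nat.eq_zero_or_pos (innerDegree d e) with hz | hpos
  · obtain rfl := eq_zero_of_innerDegree_eq_zero h0 hz
    exact ⟨0, ⟨by rw [map_zero]; omega, by omega⟩, by simp [u_zero]⟩
  obtain ⟨i, e₁, hi, hi', he, h₁⟩ := exists_inner_add hpos
  rcases Nat.eq_zero_or_pos (innerDegree d e₁) with hz | hpos'
  · obtain rfl := eq_zero_of_innerDegree_eq_zero (sub he h0) hz
    have hw : indexWeight e = i := by simp [he]
    exact ⟨0, ⟨by omega, by omega⟩, by rw [hw, u_zero, Nat.sub_zero, u_coe i hi hi', he]⟩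
  obtain ⟨j, e₂, hj, hj', he₁, h₂⟩ := exists_inner_add hpos'
  obtain rfl := eq_zero_of_innerDegree_eq_zero (sub he₁ (sub he h0)) (by omega)
  have hw : indexWeight e = j + i := by simp [he, he₁]
  rw [hw, he, he₁, zero_add]
  rcases le_total (i : ℕ) j with hij | hij
  · refine ⟨i, ⟨by omega, by omega⟩, ?_⟩
    rw [Nat.add_sub_cancel, u_coe i hi hi', u_coe j hj hj', add_comm (Finsupp.single i 1)]
  · refine ⟨j, ⟨by omega, by omega⟩, ?_⟩
    rw [Nat.add_sub_cancel_left, u_coe i hi hi', u_coe j hj hj']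

theorem tsub_single {d : ℕ} {e : Fin (d + 1) →₀ ℕ} {i : Fin (d + 1)}
    (hi : ¬(1 ≤ (i : ℕ) ∧ (i : ℕ) + 2 ≤ d)) (h : e i ≠ 0) :
    e - Finsupp.single i 1 + Finsupp.single i 1 = e ∧
      innerDegree d (e - Finsupp.single i 1) = innerDegree d e ∧
      indexWeight e = indexWeight (e - Finsupp.single i 1) + i := by
  have hle : Finsupp.single i 1 ≤ e := Finsupp.single_le_iff.2 (Nat.one_le_iff_ne_zero.2 h)
  have heq := tsub_add_cancel_of_le hle
  refine ⟨heq, ?_, ?_⟩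
  · conv_rhs => rw [← heq, map_add, innerDegree_single_of_not hi, add_zero]
  · conv_lhs => rw [← heq, map_add, indexWeight_single, one_mul]

/-- The number of standard monomials of weight `w` without `m₀` and `m_{d-1}`. -/
theorem exists_finset_inner_last {d : ℕ} (hd : 3 ≤ d) (w : ℕ) :
    ∃ F : Finset (Fin (d + 1) →₀ ℕ), F.card ≤ w / 2 + 1 - (w + 3 - d) / 2 ∧
      ∀ e : Fin (d + 1) →₀ ℕ, e 0 = 0 → e ⟨d - 1, by omega⟩ = 0 →
        innerDegree d e ≤ 2 → indexWeight e = w → e ∈ F := by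
  classical
  induction w using Nat.strong_induction_on with
  | _ w ih =>
    obtain ⟨F₀, hF₀, h₀⟩ := exists_finset_inner hd w
    have base (e : Fin (d + 1) →₀ ℕ) (he : e 0 = 0) (he' : e ⟨d - 1, by omega⟩ = 0)
        (hlast : e (Fin.last d) = 0) (hdeg : innerDegree d e ≤ 2) (hw : indexWeight e = w) :
        e ∈ F₀ := by
      refine h₀ e (fun i hi => ?_) hdeg hw
      obtain h | h | h : i = 0 ∨ i = ⟨d - 1, by omega⟩ ∨ i = Fin.last d := by
        simp only [Fin.ext_iff, Fin.val_zero, Fin.val_last]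
        omega
      all_goals rwa [h]
    have hlast : ¬(1 ≤ (Fin.last d : ℕ) ∧ (Fin.last d : ℕ) + 2 ≤ d) := by simp
    have step {e : Fin (d + 1) →₀ ℕ} (h : e (Fin.last d) ≠ 0) := tsub_single hlast h
    rcases lt_or_ge w d with hlt | hle
    · refine ⟨F₀, hF₀.trans (by omega), fun e he he' hdeg hw => base e he he' ?_ hdeg hw⟩
      by_contra hne
      have := (step hne).2.2
      rw [Fin.val_last] at this
      omega
    · obtain ⟨F₁, hF₁, h₁⟩ := ih (w - d) (by omega)
      refine ⟨F₀ ∪ F₁.image (· + Finsupp.single (Fin.last d) 1), ?_, fun e he he' hdeg hw => ?_⟩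
      · have := Finset.card_union_le F₀ (F₁.image (· + Finsupp.single (Fin.last d) 1))
        have := Finset.card_image_le (s := F₁) (f := (· + Finsupp.single (Fin.last d) 1))
        omega
      · by_cases hne : e (Fin.last d) = 0
        · exact Finset.mem_union_left _ (base e he he' hne hdeg hw)
        obtain ⟨s₁, s₂, s₃⟩ := step hne
        refine Finset.mem_union_right _ (Finset.mem_image.2 ⟨_, h₁ _ ?_ ?_ ?_ ?_, s₁⟩)
        · simp [he]
        · simp [he']
        · omega
        · rw [Fin.val_last] at s₃
          omega

/-- There are at most as many standard monomials of weight `w` without `m₀` as there are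
monomials `μ ^ a * s ^ b` with `a + 2 * b = w`. -/
theorem exists_finset_standard {d : ℕ} (hd : 3 ≤ d) (w : ℕ) :
    ∃ F : Finset (Fin (d + 1) →₀ ℕ), F.card ≤ w / 2 + 1 ∧
      ∀ e : Fin (d + 1) →₀ ℕ, e 0 = 0 → innerDegree d e ≤ 2 → indexWeight e = w → e ∈ F := by
  classical
  induction w using Nat.strong_induction_on with
  | _ w ih =>
    obtain ⟨F₀, hF₀, h₀⟩ := exists_finset_inner_last hd w
    let p : Fin (d + 1) := ⟨d - 1, by omega⟩
    have hp : (p : ℕ) = d - 1 := rfl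
    have step {e : Fin (d + 1) →₀ ℕ} (h : e p ≠ 0) := tsub_single (by omega) h
    rcases lt_or_ge w (d - 1) with hlt | hle
    · refine ⟨F₀, hF₀.trans (by omega), fun e he hdeg hw => h₀ e he ?_ hdeg hw⟩
      by_contra hne
      have := (step hne).2.2
      omega
    -- Stripping one m_{d-1} leaves weight w - (d - 1). As (w + 3 - d) / 2 = (w - (d - 1)) / 2 + 1,
    -- the two bounds add up to exactly w / 2 + 1.
    · obtain ⟨F₁, hF₁, h₁⟩ := ih (w - (d - 1)) (by omega)
      refine ⟨F₀ ∪ F₁.image (· + Finsupp.single p 1), ?_, fun e he hdeg hw => ?_⟩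
      · have := Finset.card_union_le F₀ (F₁.image (· + Finsupp.single p 1))
        have := Finset.card_image_le (s := F₁) (f := (· + Finsupp.single p 1))
        omega
      · by_cases hne : e p = 0
        · exact Finset.mem_union_left _ (h₀ e he hne hdeg hw)
        obtain ⟨s₁, s₂, s₃⟩ := step hne
        refine Finset.mem_union_right _ (Finset.mem_image.2 ⟨_, h₁ _ ?_ ?_ ?_, s₁⟩)
        · simp [he]
        · omega
        · omega

/-! ### Independence of the images of standard monomials -/

theorem isWeightedHomogeneous_momentPoly (i : ℕ) :
    IsWeightedHomogeneous ![1, 2] (momentPoly K i) i := by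
  have h0 : IsWeightedHomogeneous ![1, 2] (X 0 : MvPolynomial (Fin 2) K) 1 :=
    isWeightedHomogeneous_X K _ 0
  have h1 : IsWeightedHomogeneous ![1, 2] (X 1 : MvPolynomial (Fin 2) K) 2 :=
    isWeightedHomogeneous_X K _ 1
  induction i using Nat.twoStepInduction with
  | zero => exact isWeightedHomogeneous_one K _
  | one => exact h0
  | more i h₀ h₁ =>
    refine IsWeightedHomogeneous.add ?_ ?_
    · convert h0.mul h₁ using 1
      ring
    · convert (h1.C_mul _).mul h₀ using 1
      ring

/-- The image of a monomial under the parametrization. -/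
def momentMonomial (K : Type*) [Field K] {d : ℕ} (e : Fin (d + 1) →₀ ℕ) :
    MvPolynomial (Fin 2) K :=
  momentHom K d (monomial e 1)

theorem momentMonomial_eq_prod {d : ℕ} (e : Fin (d + 1) →₀ ℕ) :
    momentMonomial K e = ∏ i : Fin (d + 1), momentPoly K i ^ e i := by
  rw [momentMonomial, momentHom, aeval_monomial, map_one, one_mul,
    Finsupp.prod_fintype _ _ fun _ => pow_zero _]

theorem isWeightedHomogeneous_momentMonomial {d : ℕ} (e : Fin (d + 1) →₀ ℕ) :
    IsWeightedHomogeneous ![1, 2] (momentMonomial K e) (indexWeight e) := by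
  rw [momentMonomial_eq_prod, indexWeight, Finsupp.weight_eq_sum]
  exact IsWeightedHomogeneous.prod _ _ _ fun i _ => (isWeightedHomogeneous_momentPoly _).pow _

theorem momentMonomial_erase_zero {d : ℕ} (e : Fin (d + 1) →₀ ℕ) :
    momentMonomial K (e.erase 0) = momentMonomial K e := by
  rw [momentMonomial_eq_prod, momentMonomial_eq_prod]
  refine Finset.prod_congr rfl fun i _ => ?_
  by_cases hi : i = 0
  · subst hi
    simp [momentPoly]
  · rw [Finsupp.erase_ne hi]

theorem momentHom_surjective {d : ℕ} (hd : 3 ≤ d) : Function.Surjective (momentHom K d) := by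
  rw [← AlgHom.range_eq_top, eq_top_iff, ← adjoin_range_X, Algebra.adjoin_le_iff]
  have h1 : momentHom K d (X ⟨1, by omega⟩) = X 0 := by simp [momentHom, momentPoly]
  have h2 : momentHom K d (X ⟨2, by omega⟩) = X 0 * X 0 + X 1 := by simp [momentHom, momentPoly]
  rintro _ ⟨i, rfl⟩
  fin_cases i
  · exact ⟨_, h1⟩
  · exact ⟨X ⟨2, by omega⟩ - X ⟨1, by omega⟩ * X ⟨1, by omega⟩, by
      change momentHom K d _ = X 1
      rw [map_sub, map_mul, h1, h2]
      ring⟩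

/-- The exponents of the standard monomials without `m₀`. -/
def standardExponents (d : ℕ) : Set (Fin (d + 1) →₀ ℕ) := {e | e 0 = 0 ∧ innerDegree d e ≤ 2}

theorem innerDegree_erase_zero {d : ℕ} (e : Fin (d + 1) →₀ ℕ) :
    innerDegree d (e.erase 0) = innerDegree d e := by
  conv_rhs => rw [← Finsupp.erase_add_single 0 e, map_add,
    innerDegree_single_of_not (by simp), add_zero]

theorem momentHom_eq_zero_of_mem_span {d : ℕ} {f : MvPolynomial (Fin (d + 1)) K}
    (hf : f ∈ Ideal.span (Set.range (hMinor K d))) : momentHom K d f = 0 := by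
  have : Ideal.span (Set.range (hMinor K d)) ≤ RingHom.ker (momentHom K d) := by
    rw [Ideal.span_le]
    rintro _ ⟨c, rfl⟩
    exact momentHom_hMinor d c
  exact this hf

theorem span_momentMonomial [CharZero K] {d : ℕ} (hd : 3 ≤ d) :
    Submodule.span K (momentMonomial K '' standardExponents d) = ⊤ := by
  rw [eq_top_iff]
  rintro g -
  obtain ⟨f, rfl⟩ := momentHom_surjective hd g
  rw [f.as_sum, map_sum]
  refine Submodule.sum_mem _ fun e _ => ?_
  obtain ⟨a, ha, b, hb, hab⟩ := Submodule.mem_sup.1 (monomial_mem_span_hMinor_sup (K := K) e)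
  rw [← mul_one (coeff e f), ← smul_eq_mul, ← smul_monomial, map_smul, ← hab, map_add,
    momentHom_eq_zero_of_mem_span ha, zero_add]
  refine Submodule.smul_mem _ _ ?_
  rw [b.as_sum, map_sum]
  refine Submodule.sum_mem _ fun e' he' => ?_
  rw [← mul_one (coeff e' b), ← smul_eq_mul, ← smul_monomial, map_smul]
  refine Submodule.smul_mem _ _ ?_
  change momentMonomial K e' ∈ _
  rw [← momentMonomial_erase_zero]
  refine Submodule.subset_span ⟨_, ⟨by simp, ?_⟩, rfl⟩
  rw [innerDegree_erase_zero]
  exact (hb he').1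

theorem weightedHomogeneousSubmodule_le_span [CharZero K] {d : ℕ} (hd : 3 ≤ d) (w : ℕ) :
    weightedHomogeneousSubmodule K ![1, 2] w ≤
      Submodule.span K (momentMonomial K '' {e ∈ standardExponents d | indexWeight e = w}) := by
  intro g hg
  have hmap : (Submodule.span K (momentMonomial K '' standardExponents d)).map
      (weightedHomogeneousComponent ![1, 2] w) ≤
      Submodule.span K (momentMonomial K '' {e ∈ standardExponents d | indexWeight e = w}) := by
    rw [Submodule.map_span_le]
    rintro _ ⟨e, he, rfl⟩
    by_cases hw : indexWeight e = w
    · have h := isWeightedHomogeneous_momentMonomial (K := K) e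
      rw [hw] at h
      rw [h.weightedHomogeneousComponent_same]
      exact Submodule.subset_span ⟨e, ⟨he, hw⟩, rfl⟩
    · rw [(isWeightedHomogeneous_momentMonomial e).weightedHomogeneousComponent_ne w
        (Ne.symm hw)]
      exact Submodule.zero_mem _
  refine hmap ⟨g, ?_, (IsWeightedHomogeneous.weightedHomogeneousComponent_same hg)⟩
  rw [span_momentMonomial hd]
  exact Submodule.mem_top

/-- A spanning family with no more members than the dimension is independent; the monomials μ^(w-2b)
s^b bound the dimension from below. -/
theorem linearIndepOn_momentMonomial_of_weight [CharZero K] {d : ℕ} (hd : 3 ≤ d) (w : ℕ) :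
    LinearIndepOn K (momentMonomial K) {e ∈ standardExponents d | indexWeight e = w} := by
  classical
  set S := {e ∈ standardExponents d | indexWeight e = w} with hS
  obtain ⟨F, hF, hmem⟩ := exists_finset_standard hd w
  have hsub : S ⊆ F := fun e he => hmem e he.1.1 he.1.2 he.2
  have : Fintype S := (F.finite_toSet.subset hsub).fintype
  have hcard : Fintype.card S ≤ w / 2 + 1 := by
    rw [← Set.toFinset_card]
    exact (Finset.card_le_card (by simpa [Set.toFinset_subset] using hsub)).trans hF
  rw [LinearIndepOn, linearIndependent_iff_card_le_finrank_span]
  refine hcard.trans ?_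
  have hrange : Set.range (fun e : S => momentMonomial K (e : Fin (d + 1) →₀ ℕ)) =
      momentMonomial K '' S := by
    rw [Set.image_eq_range]
  rw [Set.finrank, hrange]
  have : FiniteDimensional K (Submodule.span K (momentMonomial K '' S)) :=
    FiniteDimensional.span_of_finite K ((F.finite_toSet.subset hsub).image _)
  let x : Fin (w / 2 + 1) → (Fin 2 →₀ ℕ) := fun b =>
    Finsupp.single 0 (w - 2 * b) + Finsupp.single 1 (b : ℕ)
  have hx : Function.Injective x := by
    intro b b' h
    have := DFunLike.congr_fun h 1
    simpa [x, Fin.ext_iff] using this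
  have hli : LinearIndependent K fun b => (monomial (x b) (1 : K)) := by
    have := (basisMonomials (Fin 2) K).linearIndependent.comp x hx
    simpa [Function.comp_def, coe_basisMonomials] using this
  have hxw (b) : monomial (x b) (1 : K) ∈
      Submodule.span K (momentMonomial K '' S) := by
    refine weightedHomogeneousSubmodule_le_span hd w (isWeightedHomogeneous_monomial _ _ _ ?_)
    rw [map_add, Finsupp.weight_single, Finsupp.weight_single]
    change (w - 2 * (b : ℕ)) * 1 + (b : ℕ) * 2 = w
    omega
  have hli' : LinearIndependent K fun b =>
      (⟨monomial (x b) (1 : K), hxw b⟩ : Submodule.span K (momentMonomial K '' S)) :=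
    LinearIndependent.of_comp (Submodule.subtype _) hli
  simpa using hli'.fintype_card_le_finrank

theorem linearIndepOn_momentMonomial [CharZero K] {d : ℕ} (hd : 3 ≤ d) :
    LinearIndepOn K (momentMonomial K) (standardExponents d) := by
  classical
  rw [linearIndepOn_iff']
  intro t g ht hg e he
  have h := congrArg (weightedHomogeneousComponent ![1, 2] (indexWeight e)) hg
  rw [map_sum, map_zero] at h
  have hcomp (e') : weightedHomogeneousComponent ![1, 2] (indexWeight e)
      (g e' • momentMonomial K e') =
        if indexWeight e' = indexWeight e then g e' • momentMonomial K e' else 0 := by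
    rw [map_smul]
    split_ifs with hw
    · rw [← hw, (isWeightedHomogeneous_momentMonomial e').weightedHomogeneousComponent_same]
    · rw [(isWeightedHomogeneous_momentMonomial e').weightedHomogeneousComponent_ne _
        (Ne.symm hw),
        smul_zero]
  simp only [hcomp] at h
  rw [← Finset.sum_filter] at h
  refine linearIndepOn_iff'.1 (linearIndepOn_momentMonomial_of_weight (K := K) hd (indexWeight e))
    _ g ?_ h e (by simp [he])
  intro e' he'
  rw [Finset.coe_filter] at he'
  exact ⟨ht he'.1, he'.2⟩

/-- Since m_0 maps to 1, it can be erased without changing the image; the fixed degree recovers its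
exponent. -/
theorem linearIndepOn_momentMonomial_of_degree [CharZero K] {d : ℕ} (hd : 3 ≤ d) (k : ℕ) :
    LinearIndepOn K (momentMonomial K)
      {e : Fin (d + 1) →₀ ℕ | innerDegree d e ≤ 2 ∧ e.degree = k} := by
  have hinj : Set.InjOn (Finsupp.erase (0 : Fin (d + 1)))
      {e : Fin (d + 1) →₀ ℕ | innerDegree d e ≤ 2 ∧ e.degree = k} := by
    rintro e ⟨-, he⟩ e' ⟨-, he'⟩ h
    have hk := he.trans he'.symm
    rw [← Finsupp.erase_add_single 0 e, ← Finsupp.erase_add_single 0 e', h, map_add, map_add,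
      Finsupp.degree_single, Finsupp.degree_single, add_right_inj] at hk
    rw [← Finsupp.erase_add_single 0 e, ← Finsupp.erase_add_single 0 e', h, hk]
  have himage : Finsupp.erase (0 : Fin (d + 1)) ''
      {e : Fin (d + 1) →₀ ℕ | innerDegree d e ≤ 2 ∧ e.degree = k} ⊆ standardExponents d := by
    rintro _ ⟨e, he, rfl⟩
    exact ⟨Finsupp.erase_same, by rw [innerDegree_erase_zero]; exact he.1⟩
  exact (((linearIndepOn_momentMonomial (K := K) hd).mono himage).comp_of_image hinj).congr
    fun e _ => momentMonomial_erase_zero e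

/-! ### Generation by the minors -/

theorem mem_span_hMinor [CharZero K] {d k : ℕ} (hd : 3 ≤ d) {f : MvPolynomial (Fin (d + 1)) K}
    (hf : f.IsHomogeneous k) (h : momentHom K d f = 0) :
    f ∈ Ideal.span (Set.range (hMinor K d)) := by
  have hmem : f ∈ (Ideal.span (Set.range (hMinor K d))).restrictScalars K ⊔
      restrictSupport K {e | innerDegree d e ≤ 2 ∧ e.degree = k} := by
    rw [f.as_sum]
    refine Submodule.sum_mem _ fun e he => ?_
    have hdeg : e.degree = k := by
      by_contra hne
      exact mem_support_iff.1 he (hf.coeff_eq_zero hne)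
    rw [← mul_one (coeff e f), ← smul_eq_mul, ← smul_monomial, ← hdeg]
    exact Submodule.smul_mem _ _ (monomial_mem_span_hMinor_sup e)
  obtain ⟨a, ha, b, hb, rfl⟩ := Submodule.mem_sup.1 hmem
  rw [map_add, momentHom_eq_zero_of_mem_span ha, zero_add, b.as_sum, map_sum] at h
  have h' : ∑ e ∈ b.support, coeff e b • momentMonomial K e = 0 := by
    rw [← h]
    refine Finset.sum_congr rfl fun e _ => ?_
    rw [momentMonomial, ← map_smul, smul_monomial, smul_eq_mul, mul_one]
  have hcoeff := linearIndepOn_iff'.1 (linearIndepOn_momentMonomial_of_degree (K := K) hd k)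
    b.support (fun e => coeff e b) hb h'
  have hb0 : b = 0 := by
    rw [← support_eq_empty, Finset.eq_empty_iff_forall_notMem]
    exact fun e he => mem_support_iff.1 he (hcoeff e he)
  rw [hb0, add_zero]
  exact ha

theorem span_hMinor_eq [CharZero K] {d : ℕ} (hd : 3 ≤ d) :
    Ideal.span (Set.range (hMinor K d)) = projectiveIdeal (momentSurface K d) := by
  refine le_antisymm (Ideal.span_le.2 ?_) (Ideal.span_le.2 fun f hf => ?_)
  · rintro _ ⟨c, rfl⟩
    exact mem_projectiveIdeal_momentSurface (isHomogeneous_hMinor d c) (momentHom_hMinor d c)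
  · obtain ⟨⟨k, hk⟩, h⟩ := mem_homogeneousVanishing_momentSurface.1 hf
    exact mem_span_hMinor hd hk h

/-! ### Minimality of the generators -/

/-- The homogeneous component of the lowest possible degree of a multiple. -/
theorem homogeneousComponent_mul_of_coeff_eq_zero {σ : Type*} {k : ℕ} {t : MvPolynomial σ K}
    (ht : ∀ e : σ →₀ ℕ, e.degree < k → coeff e t = 0) (r : MvPolynomial σ K) :
    homogeneousComponent k (r * t) = coeff 0 r • homogeneousComponent k t := by
  classical
  ext e
  rw [coeff_smul, coeff_homogeneousComponent, coeff_homogeneousComponent]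
  split_ifs with he
  · rw [coeff_mul, Finset.sum_eq_single_of_mem (0, e) (by simp), smul_eq_mul]
    rintro ⟨u, v⟩ huv hne
    rw [Finset.HasAntidiagonal.mem_antidiagonal] at huv
    simp only at huv ⊢
    rw [ht v, mul_zero]
    have hu : u ≠ 0 := by
      rintro rfl
      exact hne (by rw [← huv, zero_add])
    have := (Finsupp.degree_eq_zero_iff u).not.2 hu
    rw [← he, ← huv, map_add]
    omega
  · rw [smul_zero]

theorem coeff_eq_zero_of_mem_span {σ : Type*} {k : ℕ} {S : Set (MvPolynomial σ K)}
    (hS : ∀ f ∈ S, f.IsHomogeneous k) {f : MvPolynomial σ K} (hf : f ∈ Ideal.span S)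
    {e : σ →₀ ℕ} (he : e.degree < k) : coeff e f = 0 := by
  classical
  induction hf using Submodule.span_induction generalizing e with
  | mem f hf => exact (hS f hf).coeff_eq_zero he.ne
  | zero => exact coeff_zero e
  | add f g _ _ hf hg => rw [coeff_add, hf he, hg he, add_zero]
  | smul r f _ hf =>
    rw [smul_eq_mul, coeff_mul]
    refine Finset.sum_eq_zero fun x hx => ?_
    rw [hf, mul_zero]
    rw [← Finset.HasAntidiagonal.mem_antidiagonal.1 hx, map_add] at he
    omega

/-- A linearly independent family of forms of degree `k` is a minimal generating set of the ideal
that it generates. -/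
theorem card_le_card_of_span_eq {σ ι : Type*} [Fintype ι] {k : ℕ} {v : ι → MvPolynomial σ K}
    (hv : ∀ i, (v i).IsHomogeneous k) (hli : LinearIndependent K v)
    {T : Finset (MvPolynomial σ K)}
    (hT : Ideal.span (T : Set (MvPolynomial σ K)) = Ideal.span (Set.range v)) :
    Fintype.card ι ≤ T.card := by
  classical
  have hlow (t) (ht : t ∈ Ideal.span (T : Set (MvPolynomial σ K))) (e : σ →₀ ℕ)
      (he : e.degree < k) : coeff e t = 0 := by
    rw [hT] at ht
    exact coeff_eq_zero_of_mem_span (by rintro _ ⟨i, rfl⟩; exact hv i) ht he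
  set W := Submodule.span K (T.image (homogeneousComponent k) : Set (MvPolynomial σ K)) with hW
  -- The ideal has no terms below degree `k`, so only the constant terms of the multipliers reach
  -- degree `k`: there the ideal is spanned over `K` by the components of `T`.
  have key (f) (hf : f ∈ Ideal.span (T : Set (MvPolynomial σ K))) :
      homogeneousComponent k f ∈ W := by
    induction hf using Submodule.span_induction with
    | mem f hf => exact Submodule.subset_span (Finset.mem_coe.2 (Finset.mem_image_of_mem _ hf))
    | zero => rw [map_zero]; exact W.zero_mem
    | add f g _ _ hf hg => rw [map_add]; exact W.add_mem hf hg
    | smul r f hf' hf =>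
      rw [smul_eq_mul, homogeneousComponent_mul_of_coeff_eq_zero (hlow f hf')]
      exact W.smul_mem _ hf
  have hmem (i) : v i ∈ W := by
    have := key (v i) (by rw [hT]; exact Ideal.subset_span ⟨i, rfl⟩)
    rwa [homogeneousComponent_eq_self (hv i)] at this
  have : FiniteDimensional K W := FiniteDimensional.span_finset K _
  have hli' : LinearIndependent K fun i => (⟨v i, hmem i⟩ : W) :=
    LinearIndependent.of_comp (Submodule.subtype _) hli
  exact hli'.fintype_card_le_finrank.trans
    ((finrank_span_finset_le_card _).trans Finset.card_image_le)

theorem choose_le_card_of_span_eq [CharZero K] {d : ℕ} (hd : 3 ≤ d)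
    {T : Finset (MvPolynomial (Fin (d + 1)) K)}
    (hT : Ideal.span (T : Set (MvPolynomial (Fin (d + 1)) K)) =
      projectiveIdeal (momentSurface K d)) : d.choose 3 ≤ T.card := by
  have : Fintype (Fin 3 ↪o Fin d) := Fintype.ofFinite _
  rw [← span_hMinor_eq hd] at hT
  have h := card_le_card_of_span_eq (isHomogeneous_hMinor (K := K) d)
    (linearIndependent_hMinor d) hT
  rwa [← Nat.card_eq_fintype_card,
    ← Set.ncard_range_of_injective (linearIndependent_hMinor (K := K) d).injective,
    ncard_range_hMinor] at h

theorem span_ne_of_ssubset [CharZero K] {d : ℕ} (hd : 3 ≤ d)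
    {T : Set (MvPolynomial (Fin (d + 1)) K)} (hT : T ⊂ Set.range (hMinor K d)) :
    Ideal.span T ≠ projectiveIdeal (momentSurface K d) := by
  intro h
  have hfin : (Set.range (hMinor K d)).Finite := Set.finite_range _
  have hTfin : T.Finite := hfin.subset hT.subset
  have h₁ := Set.ncard_lt_ncard hT hfin
  rw [ncard_range_hMinor, Set.ncard_eq_toFinset_card T hTfin] at h₁
  exact h₁.not_ge (choose_le_card_of_span_eq hd (by rwa [hTfin.coe_toFinset]))

end GaussianMoments

end

open GaussianMoments in
theorem mainTheorem3 (K : Type*) [Field K] [CharZero K] (d : ℕ) (hd : 3 ≤ d) :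
    -- the ideal of the moment surface is a homogeneous prime ideal
    (projectiveIdeal (momentSurface K d)).IsPrime ∧
    (projectiveIdeal (momentSurface K d)).IsHomogeneous
      (MvPolynomial.homogeneousSubmodule (Fin (d + 1)) K) ∧
    -- the minors are `d.choose 3` distinct cubics
    (∀ c : Fin 3 ↪o Fin d, hMinor K d c ≠ 0 ∧ (hMinor K d c).IsHomogeneous 3) ∧
    (Set.range (hMinor K d)).ncard = d.choose 3 ∧
    -- they generate the ideal
    Ideal.span (Set.range (hMinor K d)) = projectiveIdeal (momentSurface K d) ∧
    -- no proper subset generates it, and no generating set has fewer elements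
    (∀ T : Set (MvPolynomial (Fin (d + 1)) K), T ⊂ Set.range (hMinor K d) →
      Ideal.span T ≠ projectiveIdeal (momentSurface K d)) ∧
    (∀ T : Finset (MvPolynomial (Fin (d + 1)) K),
      Ideal.span (T : Set (MvPolynomial (Fin (d + 1)) K)) = projectiveIdeal (momentSurface K d) →
      d.choose 3 ≤ T.card) ∧
    -- the moments satisfy the recurrence that is encoded in the matrix
    (∀ μ s : K, moment μ s 1 = μ * moment μ s 0 ∧
      ∀ i : ℕ, 2 ≤ i →
        moment μ s i = μ * moment μ s (i - 1) + ((i : K) - 1) * s * moment μ s (i - 2)) := by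
  refine ⟨isPrime_projectiveIdeal_momentSurface d, isHomogeneous_projectiveIdeal _,
    fun c => ⟨(linearIndependent_hMinor d).ne_zero c, isHomogeneous_hMinor d c⟩,
    ncard_range_hMinor d, span_hMinor_eq hd, fun T hT => span_ne_of_ssubset hd hT,
    fun T hT => choose_le_card_of_span_eq hd hT, fun μ s => ⟨?_, fun i hi => ?_⟩⟩
  · rw [moment_one, moment_zero, mul_one]
  · obtain ⟨i, rfl⟩ := Nat.exists_eq_add_of_le' hi
    rw [moment_succ_succ]
    change _ = μ * moment μ s (i + 1) + (((i + 2 : ℕ) : K) - 1) * s * moment μ s i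
    push_cast
    ring
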